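/- Let $q$ be a prime power and let $n\ge 4$. For an $n\times n$ matrix $A$ over $\mathrm{GF}(q)$ let $L(A)$ and $L'(A)$ be the row spaces in $\mathrm{GF}(q)^{2n}$ of the $n\times 2n$ matrices $(I_n\,|\,A)$ and $(A\,|\,I_n)$. A $\mathrm{GF}(q)$-linear $(n,n,n-1)$ MRD code is a $\mathrm{GF}(q)$-subspace $\mathcal M$ of the space of $n\times n$ matrices over $\mathrm{GF}(q)$ with $|\mathcal M|=q^{n(n-1)}$ and $\min\{\operatorname{rk}(A-B): A,B\in\mathcal M,\ A\ne B\}=2$. A $(2n,M,4;n)_q$ constant-dimension subspace code is a set $\mathcal C$ of $M$ subspaces of dimension $n$ of $\mathrm{GF}(q)^{2n}$ such that $\min\{\dim(U+U')-\dim(U\cap U'): U,U'\in\mathcal C,\ U\neq U'\}=4$. For $0\le r\le m$ put $\genfrac{[}{]}{0pt}{}{m}{r}_q=\prod_{i=0}^{r-1}\frac{q^{m-i}-1}{q^{r-i}-1}$. (a) There are a primitive element $\omega$ of $\mathrm{GF}(q^n)$, a matrix $C\in \mathrm{GL}(n,q)$ and $E\in\mathrm{GL}(n,q^n)$ with $E^{-1}CE=\operatorname{diag}(\omega,\omega^q,\dots,\omega^{q^{n-1}})$;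 and for all such $\omega,C,E$, the set of all $n\times n$ matrices $A$ over $\mathrm{GF}(q)$ such that all diagonal entries of $E^{-1}A(E^{-1})^{T}$ vanish is a $\mathrm{GF}(q)$-linear $(n,n,n-1)$ MRD code that contains all skew-symmetric matrices with zero diagonal. (b) Let $\mathcal M$ be the code of (a) or, more generally, any $\mathrm{GF}(q)$-linear $(n,n,n-1)$ MRD code. For $2\le r\le n-2$ let $\mathcal C_r$ be the set of all matrices of rank $r$ in $\mathcal M$. Let $\mathcal L_1=\{L(A):A\in\mathcal M\}$ and $\mathcal L_r=\{L'(A):A\in\mathcal C_r\}$ for $2\le r\le n-2$. Then $\bigcup_{i=1}^{n-2}\mathcal L_i$ is a $(2n,M,4;n)_q$ constant-dimension subspace code, where $$M=q^{n^2-n}+\sum_{r=2}^{n-2}\genfrac{[}{]}{0pt}{}{n}{r}_q\sum_{j=2}^{r}(-1)^{r-j}\genfrac{[}{]}{0pt}{}{r}{j}_q\,q^{\binom{r-j}{2}}\bigl(q^{n(j-1)}-1\bigr).$$ -/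

import Mathlib

namespace SubspaceCodes

/-! ### Subspace codes -/

section Subspace

variable {F V : Type*} [Field F] [AddCommGroup V] [Module F V]

/-- The subspace distance `dim (U + W) - dim (U ∩ W)` (the difference is a true one, since
`U ⊓ W ≤ U ⊔ W`, in a finite-dimensional space). -/
noncomputable def subspaceDist (U W : Submodule F V) : ℕ :=
  Module.finrank F ↥(U ⊔ W) - Module.finrank F ↥(U ⊓ W)

/-- `𝓒` is an `(r, M, d; k)_q` constant-dimension subspace code in the space `V` over the field
`F` with `q` elements: `V` has dimension `r`, `𝓒` is a set of exactly `M` subspaces of dimension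
`k`, and the minimum subspace distance of two different members of `𝓒` is exactly `d`. -/
def IsConstantDimensionCode (r M d k : ℕ) (𝓒 : Set (Submodule F V)) : Prop :=
  Module.finrank F V = r ∧
  𝓒.Finite ∧ 𝓒.ncard = M ∧
  (∀ U ∈ 𝓒, Module.finrank F ↥U = k) ∧
  IsLeast {t : ℕ | ∃ U ∈ 𝓒, ∃ W ∈ 𝓒, U ≠ W ∧ t = subspaceDist U W} d

end Subspace

/-! ### Rank distance codes -/

/-- `𝓐` is an `(m, n, k)` maximum rank distance code over `F`: its minimum rank distance is
`d = min m n - k + 1`, and its size attains the maximum `q ^ (max m n * (min m n - d + 1))`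
possible for that distance. -/
def IsMRD {F : Type*} [Field F] [Fintype F] {m n : ℕ} (k : ℕ)
    (𝓐 : Set (Matrix (Fin m) (Fin n) F)) : Prop :=
  1 ≤ k ∧ k ≤ min m n ∧
  IsLeast {t : ℕ | ∃ A ∈ 𝓐, ∃ B ∈ 𝓐, A ≠ B ∧ t = (A - B).rank} (min m n - k + 1) ∧
  𝓐.ncard = Fintype.card F ^ (max m n * k)

/-- The set of all codewords of rank `r` in `𝓐`. -/
def rankPart {F : Type*} [Field F] {m n : ℕ} (𝓐 : Set (Matrix (Fin m) (Fin n) F)) (r : ℕ) :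
    Set (Matrix (Fin m) (Fin n) F) :=
  {A | A ∈ 𝓐 ∧ A.rank = r}

/-! ### Lifting -/

section Lift

variable {F : Type*} [Field F] {n : ℕ}

/-- `L(A)`, the row space of the `n × 2n` matrix `(I | A)`. -/
def lift (A : Matrix (Fin n) (Fin n) F) : Submodule F (Fin n ⊕ Fin n → F) :=
  Submodule.span F (Set.range (Matrix.fromCols (1 : Matrix (Fin n) (Fin n) F) A).row)

/-- `L'(A)`, the row space of the `n × 2n` matrix `(A | I)`. -/
def lift' (A : Matrix (Fin n) (Fin n) F) : Submodule F (Fin n ⊕ Fin n → F) :=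
  Submodule.span F (Set.range (Matrix.fromCols A (1 : Matrix (Fin n) (Fin n) F)).row)

/-- The union of `{L(A) : A ∈ 𝓜}` and of the sets `{L'(A) : A ∈ 𝓜, rank A = r}`,
`2 ≤ r ≤ n - 2`. -/
def liftedUnion (𝓜 : Set (Matrix (Fin n) (Fin n) F)) :
    Set (Submodule F (Fin n ⊕ Fin n → F)) :=
  lift '' 𝓜 ∪ ⋃ r ∈ Finset.Icc 2 (n - 2), lift' '' rankPart 𝓜 r

end Lift

/-! ### The linear MRD code obtained from a Singer cycle -/

section Singer

variable {F K : Type*} [Field F] [Field K] [Algebra F K] {n : ℕ}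

/-- The skew-symmetric matrices with zero diagonal (the diagonal condition is automatic in odd
characteristic). -/
def skewMatrices (F : Type*) [Field F] (n : ℕ) : Submodule F (Matrix (Fin n) (Fin n) F) where
  carrier := {A | A.transpose = -A ∧ ∀ i, A i i = 0}
  zero_mem' := by simp
  add_mem' := by
    rintro A B ⟨hA, hA'⟩ ⟨hB, hB'⟩
    refine ⟨?_, fun i => by simp [hA' i, hB' i]⟩
    rw [Matrix.transpose_add, hA, hB, neg_add]
  smul_mem' := by
    rintro c A ⟨hA, hA'⟩
    refine ⟨?_, fun i => by simp [hA' i]⟩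
    rw [Matrix.transpose_smul, hA, smul_neg]

/-- `C` is a Singer cycle of `GL(n, q)`, diagonalised by `E` over the field `K` with `q ^ n`
elements: `E⁻¹ C E = diag (ω, ω ^ q, …, ω ^ (q ^ (n - 1)))` for the primitive element `ω` of
`K`. -/
structure IsSingerDiagonalization [Fintype F] (ω : K) (C : Matrix (Fin n) (Fin n) F)
    (E : Matrix (Fin n) (Fin n) K) : Prop where
  finrank_eq : Module.finrank F K = n
  primitive : ω ≠ 0 ∧ ∀ x : K, x ≠ 0 → ∃ k : ℕ, x = ω ^ k
  isUnit_det : IsUnit E.det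
  diagonal : E⁻¹ * C.map (algebraMap F K) * E =
    Matrix.diagonal fun i : Fin n => ω ^ Fintype.card F ^ (i : ℕ)

/-- The matrices `A` over `F` whose transform under `(E ⊗ E)⁻¹`, that is `E⁻¹ A (E⁻¹)ᵀ`, lies in
the span of the off-diagonal coordinate vectors. -/
noncomputable def singerCode (F : Type*) [Field F] [Algebra F K] (E : Matrix (Fin n) (Fin n) K) :
    Submodule F (Matrix (Fin n) (Fin n) F) where
  carrier := {A | ∀ i, (E⁻¹ * A.map (algebraMap F K) * (E⁻¹).transpose) i i = 0}
  zero_mem' := by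
    intro i
    simp
  add_mem' := by
    intro A B hA hB i
    have h : (A + B).map (algebraMap F K) = A.map (algebraMap F K) + B.map (algebraMap F K) :=
      Matrix.map_add _ (map_add _) A B
    rw [h, Matrix.mul_add, Matrix.add_mul, Matrix.add_apply, hA i, hB i, add_zero]
  smul_mem' := by
    intro c A hA i
    have h : (c • A).map (algebraMap F K) = algebraMap F K c • A.map (algebraMap F K) := by
      ext
      simp
    rw [h, Matrix.mul_smul, Matrix.smul_mul, Matrix.smul_apply, hA i, smul_zero]

end Singer

/-! ### The size -/

/-- The Gaussian binomial coefficient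
`((q ^ n - 1) ⋯ (q ^ (n - r + 1) - 1)) / ((q ^ r - 1) ⋯ (q - 1))`, for `r ≤ n`. -/
def gaussBinom (q n r : ℕ) : ℚ :=
  (∏ i ∈ Finset.range r, ((q : ℚ) ^ (n - i) - 1)) / ∏ i ∈ Finset.range r, ((q : ℚ) ^ (r - i) - 1)

/-- The number
`q ^ (n² - n) + ∑_{r=2}^{n-2} [n, r]_q ∑_{j=2}^r (-1)^(r-j) [r, j]_q q^((r-j) choose 2)
(q^(n(j-1)) - 1)`. -/
def codeSize (q n : ℕ) : ℚ :=
  (q : ℚ) ^ (n ^ 2 - n) +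
    ∑ r ∈ Finset.Icc 2 (n - 2), gaussBinom q n r *
      ∑ j ∈ Finset.Icc 2 r, (-1 : ℚ) ^ (r - j) * gaussBinom q r j *
        (q : ℚ) ^ (r - j).choose 2 * ((q : ℚ) ^ (n * (j - 1)) - 1)

end SubspaceCodes

namespace SubspaceCodes

/-! ### Gaussian binomial coefficients -/

section Gauss

variable (q : ℕ)

/-! For the Singer code, the rows of `E⁻¹` are left eigenvectors of `C` for distinct conjugate
eigenvalues. As `C` has entries in `F`, they are up to scalars the Frobenius conjugates of one
vector `x`, whose entries form a basis of `K` over `F`. The `i`-th diagonal entry of `E⁻¹ A (E⁻¹)ᵀ`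
is the quadratic form of `A` at row `i`, so all `n` conditions amount to `quadEval F x A = 0`. This
`F`-linear map onto `K` has a kernel of codimension `n`. It is nonzero on a matrix of rank one,
where it is a product of two nonzero elements of `K`, and it kills the skew matrices.

For the union, `L(A) ∩ L(B)` has dimension `n - rank (A - B)`, while `L(A) ∩ L'(B)` embeds in the
row space of `B`. Ranks between `2` and `n - 2` thus give distance at least `4` in all cases. The
size requires the rank distribution of a linear MRD code `M`: by `finrank_inf_rowsIn`, the codewords
with row space inside `U` form a space whose dimension depends only on `dim U`. Gauss inversion over
the subspace lattice (`eq_qInversion_of_sum_le`) then counts those with row space exactly `U`, and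
`card_submodule_finrank_eq` counts the choices of `U`. -/

theorem gaussBinom_zero_right (n : ℕ) : gaussBinom q n 0 = 1 := by simp [gaussBinom]

theorem gaussBinom_eq_zero_of_lt {n r : ℕ} (h : n < r) : gaussBinom q n r = 0 := by
  unfold gaussBinom
  -- The numerator contains the factor `q ^ 0 - 1`.
  rw [Finset.prod_eq_zero (i := n) (Finset.mem_range.2 h) (by simp), zero_div]

variable {q}

theorem cast_pow_sub_one_pos (hq : 2 ≤ q) {k : ℕ} (hk : k ≠ 0) : (0 : ℚ) < (q : ℚ) ^ k - 1 := by
  have : (1 : ℚ) < (q : ℚ) ^ k := one_lt_pow₀ (by exact_mod_cast hq) hk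
  linarith

/-- The denominator of the Gaussian binomial coefficient, `(q ^ r - 1) ⋯ (q - 1)`. -/
def qFactorial (q r : ℕ) : ℚ := ∏ i ∈ Finset.range r, ((q : ℚ) ^ (r - i) - 1)

theorem qFactorial_pos (hq : 2 ≤ q) (r : ℕ) : 0 < qFactorial q r :=
  Finset.prod_pos fun i hi => cast_pow_sub_one_pos hq (by have := Finset.mem_range.1 hi; omega)

theorem gaussBinom_eq_div (hq : 2 ≤ q) {n r : ℕ} (h : r ≤ n) :
    gaussBinom q n r = qFactorial q n / (qFactorial q r * qFactorial q (n - r)) := by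
  have key : qFactorial q n =
      (∏ i ∈ Finset.range r, ((q : ℚ) ^ (n - i) - 1)) * qFactorial q (n - r) := by
    unfold qFactorial
    conv_lhs => rw [show n = r + (n - r) by omega]
    rw [Finset.prod_range_add]
    congr 1
    · exact Finset.prod_congr rfl fun i _ => by congr 2; omega
    · exact Finset.prod_congr rfl fun i _ => by congr 2; omega
  have h2 := (qFactorial_pos hq (n - r)).ne'
  rw [key, mul_div_mul_right _ _ h2]
  rfl

theorem gaussBinom_symm (hq : 2 ≤ q) {n r : ℕ} (h : r ≤ n) :
    gaussBinom q n (n - r) = gaussBinom q n r := by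
  rw [gaussBinom_eq_div hq h, gaussBinom_eq_div hq (Nat.sub_le n r),
    show n - (n - r) = r by omega, mul_comm (qFactorial q r)]

/-- Both sides count flags of dimensions `i ≤ j` in an `r`-space. On the right the first factor is
free of `j`, so the inner sum of the inversion can run over `j`. -/
theorem gaussBinom_mul_gaussBinom (hq : 2 ≤ q) {r j i : ℕ} (hij : i ≤ j) (hjr : j ≤ r) :
    gaussBinom q r j * gaussBinom q j i = gaussBinom q r i * gaussBinom q (r - i) (j - i) := by
  rw [gaussBinom_eq_div hq hij, gaussBinom_eq_div hq hjr, gaussBinom_eq_div hq (hij.trans hjr),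
    gaussBinom_eq_div hq (show j - i ≤ r - i by omega), show r - i - (j - i) = r - j by omega]
  have h1 := (qFactorial_pos hq r).ne'
  have h2 := (qFactorial_pos hq j).ne'
  have h3 := (qFactorial_pos hq i).ne'
  have h4 := (qFactorial_pos hq (r - j)).ne'
  have h5 := (qFactorial_pos hq (j - i)).ne'
  have h6 := (qFactorial_pos hq (r - i)).ne'
  field_simp

/-- The `q`-Pascal rule, in the form that makes the partial alternating sums below telescope. -/
theorem gaussBinom_succ_succ (hq : 2 ≤ q) {m t : ℕ} (h : t ≤ m) :
    gaussBinom q (m + 1) (t + 1) =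
      gaussBinom q m t + (q : ℚ) ^ (t + 1) * gaussBinom q m (t + 1) := by
  have hD : ∏ i ∈ Finset.range (t + 1), ((q : ℚ) ^ (t + 1 - i) - 1) =
      (∏ i ∈ Finset.range t, ((q : ℚ) ^ (t - i) - 1)) * ((q : ℚ) ^ (t + 1) - 1) := by
    rw [Finset.prod_range_succ']
    simp
  have hN : ∏ i ∈ Finset.range (t + 1), ((q : ℚ) ^ (m + 1 - i) - 1) =
      (∏ i ∈ Finset.range t, ((q : ℚ) ^ (m - i) - 1)) * ((q : ℚ) ^ (m + 1) - 1) := by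
    rw [Finset.prod_range_succ']
    simp
  have h1 : ∏ i ∈ Finset.range t, ((q : ℚ) ^ (t - i) - 1) ≠ 0 := (qFactorial_pos hq t).ne'
  have h2 := (cast_pow_sub_one_pos hq (Nat.succ_ne_zero t)).ne'
  have h3 : (q : ℚ) ^ (m + 1) = (q : ℚ) ^ (t + 1) * (q : ℚ) ^ (m - t) := by
    rw [← pow_add]; congr 1; omega
  simp only [gaussBinom]
  rw [hD, hN, Finset.prod_range_succ, h3]
  field_simp
  ring

/-- A closed form for the partial sums makes induction possible; the full sum vanishes because
`gaussBinom q m (m + 1) = 0`. -/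
theorem sum_range_alternating_gaussBinom (hq : 2 ≤ q) (m t : ℕ) (ht : t ≤ m + 1) :
    ∑ k ∈ Finset.range (t + 1), (-1 : ℚ) ^ k * gaussBinom q (m + 1) k * (q : ℚ) ^ k.choose 2 =
      (-1) ^ t * (q : ℚ) ^ (t + 1).choose 2 * gaussBinom q m t := by
  induction t with
  | zero => simp [gaussBinom_zero_right]
  | succ t ih =>
    rw [Finset.sum_range_succ, ih (by omega), gaussBinom_succ_succ hq (by omega),
      Nat.choose_succ_succ' (t + 1) 1, pow_add]
    simp only [Nat.choose_one_right]
    ring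

/-- The `q`-analogue of the vanishing of the alternating sum of a row of binomial
coefficients. -/
theorem alternating_sum_gaussBinom (hq : 2 ≤ q) {m : ℕ} (hm : m ≠ 0) :
    ∑ k ∈ Finset.range (m + 1), (-1 : ℚ) ^ k * gaussBinom q m k * (q : ℚ) ^ k.choose 2 = 0 := by
  obtain ⟨m, rfl⟩ := Nat.exists_eq_succ_of_ne_zero hm
  rw [Nat.succ_eq_add_one, sum_range_alternating_gaussBinom hq m (m + 1) le_rfl,
    gaussBinom_eq_zero_of_lt q (Nat.lt_succ_self m), mul_zero]

/-- Equivalently, `qInversion` sends the constant function `1` to `0` at every `m ≠ 0`. -/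
theorem alternating_sum_gaussBinom_reflect (hq : 2 ≤ q) {m : ℕ} (hm : m ≠ 0) :
    ∑ k ∈ Finset.range (m + 1),
      (-1 : ℚ) ^ (m - k) * gaussBinom q m k * (q : ℚ) ^ (m - k).choose 2 = 0 := by
  rw [← alternating_sum_gaussBinom hq hm, ← Finset.sum_range_reflect]
  refine Finset.sum_congr rfl fun k hk => ?_
  have hk' : k ≤ m := by have := Finset.mem_range.1 hk; omega
  rw [show m + 1 - 1 - k = m - k by omega, gaussBinom_symm hq hk', show m - (m - k) = k by omega]

/-- The `q`-binomial transform with signs. -/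
def qInversion (q : ℕ) (f : ℕ → ℚ) (r : ℕ) : ℚ :=
  ∑ j ∈ Finset.range (r + 1),
    (-1 : ℚ) ^ (r - j) * gaussBinom q r j * (q : ℚ) ^ (r - j).choose 2 * f j

/-- Gauss inversion. -/
theorem sum_gaussBinom_mul_qInversion (hq : 2 ≤ q) (f : ℕ → ℚ) (r : ℕ) :
    ∑ j ∈ Finset.range (r + 1), gaussBinom q r j * qInversion q f j = f r := by
  simp only [qInversion, Finset.mul_sum]
  rw [Finset.sum_sigma', Finset.sum_bij' (t := (Finset.range (r + 1)).sigma
    fun i => Finset.range (r - i + 1))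
    (g := fun p => f p.1 * gaussBinom q r p.1 *
      ((-1) ^ p.2 * gaussBinom q (r - p.1) p.2 * (q : ℚ) ^ p.2.choose 2))
    (fun p _ => ⟨p.2, p.1 - p.2⟩) (fun p _ => ⟨p.1 + p.2, p.1⟩)]
  -- After the exchange of summations, the coefficient of `f i` is a multiple of the alternating row
  -- sum for `r - i`, which vanishes unless `i = r`.
  · rw [Finset.sum_sigma, Finset.sum_eq_single_of_mem r (by simp)]
    · simp [gaussBinom_zero_right, ← Finset.mul_sum]
      rw [← gaussBinom_symm hq le_rfl]
      simp [gaussBinom_zero_right]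
    · intro i hi hir
      have : i < r := by have := Finset.mem_range.1 hi; omega
      simp only
      rw [← Finset.mul_sum, alternating_sum_gaussBinom hq (by omega), mul_zero]
  · rintro ⟨j, i⟩ h
    simp only [Finset.mem_sigma, Finset.mem_range] at h ⊢
    omega
  · rintro ⟨j, i⟩ h
    simp only [Finset.mem_sigma, Finset.mem_range] at h ⊢
    omega
  · rintro ⟨j, i⟩ h
    simp only [Finset.mem_sigma, Finset.mem_range] at h
    simp only [Sigma.mk.injEq, heq_eq_eq, and_true]
    omega
  · rintro ⟨j, i⟩ h
    simp only [Finset.mem_sigma, Finset.mem_range] at h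
    simp
  · rintro ⟨j, i⟩ h
    simp only [Finset.mem_sigma, Finset.mem_range] at h
    have := gaussBinom_mul_gaussBinom hq (show i ≤ j by omega) (show j ≤ r by omega)
    simp only
    linear_combination ((-1) ^ (j - i) * (q : ℚ) ^ (j - i).choose 2 * f i) * this

end Gauss

/-! ### Counting subspaces over a finite field -/

section Count

open Module

variable {F V : Type*} [Field F] [AddCommGroup V] [Module F V]

/-- The bases of a subspace `U` of dimension `k` are the linearly independent `k`-tuples that
span `U`. -/
def linearIndependentFiberEquiv [FiniteDimensional F V] {k : ℕ} (U : Submodule F V)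
    (hU : finrank F U = k) :
    {s : {s : Fin k → V // LinearIndependent F s} // Submodule.span F (Set.range s.1) = U} ≃
      {s : Fin k → U // LinearIndependent F s} where
  toFun s := ⟨fun i => ⟨s.1.1 i, s.2.le (Submodule.subset_span (Set.mem_range_self i))⟩,
    LinearIndependent.of_comp U.subtype s.1.2⟩
  invFun s := ⟨⟨fun i => s.1 i, s.2.map' U.subtype U.ker_subtype⟩, by
    refine Submodule.eq_of_le_of_finrank_eq ?_ ?_
    · rw [Submodule.span_le]
      rintro _ ⟨i, rfl⟩
      exact (s.1 i).2
    · exact (finrank_span_eq_card (s.2.map' U.subtype U.ker_subtype)).trans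
        ((Fintype.card_fin k).trans hU.symm)⟩
  left_inv _ := rfl
  right_inv _ := rfl

/-- Extracting `q ^ i` from each factor leaves a prefactor independent of `n`, which cancels when
tuples in `V` are divided by bases of a `k`-space. -/
theorem prod_pow_sub_pow {q n k : ℕ} (hq : 2 ≤ q) (hk : k ≤ n) :
    ((∏ i : Fin k, (q ^ n - q ^ i.val) : ℕ) : ℚ) =
      (∏ i ∈ Finset.range k, (q : ℚ) ^ i) * ∏ i ∈ Finset.range k, ((q : ℚ) ^ (n - i) - 1) := by
  rw [Fin.prod_univ_eq_prod_range (fun i => q ^ n - q ^ i) k, Nat.cast_prod,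
    ← Finset.prod_mul_distrib]
  refine Finset.prod_congr rfl fun i hi => ?_
  have hi' := Finset.mem_range.1 hi
  rw [Nat.cast_sub (Nat.pow_le_pow_right (by omega) (by omega)), mul_sub, ← pow_add,
    show i + (n - i) = n by omega]
  push_cast
  ring

/-- The number of `k`-dimensional subspaces is a Gaussian binomial coefficient. -/
theorem card_submodule_finrank_eq [Fintype F] [FiniteDimensional F V] (k : ℕ) :
    (Nat.card {U : Submodule F V // finrank F U = k} : ℚ) =
      gaussBinom (Fintype.card F) (finrank F V) k := by
  have : Finite V := Module.finite_of_finite F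
  have : Fintype V := Fintype.ofFinite V
  have hq : 2 ≤ Fintype.card F := Fintype.one_lt_card
  rcases lt_or_ge (finrank F V) k with hk | hk
  · rw [gaussBinom_eq_zero_of_lt _ hk, Nat.cast_eq_zero, Nat.card_eq_zero]
    exact Or.inl ⟨fun U => by have := Submodule.finrank_le U.1; have := U.2; omega⟩
  have hN := card_linearIndependent (K := F) (V := V) hk
  -- The independent tuples are grouped by their span; each fibre is the set of ordered bases of a
  -- `k`-dimensional space.
  have hfib : Nat.card {s : Fin k → V // LinearIndependent F s} =
      Nat.card {U : Submodule F V // finrank F U = k} *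
        ∏ i : Fin k, (Fintype.card F ^ k - Fintype.card F ^ i.val) := by
    let f : {s : Fin k → V // LinearIndependent F s} → {U : Submodule F V // finrank F U = k} :=
      fun s => ⟨Submodule.span F (Set.range s.1), by
        rw [finrank_span_eq_card s.2, Fintype.card_fin]⟩
    have : Fintype {U : Submodule F V // finrank F U = k} := Fintype.ofFinite _
    rw [Nat.card_congr (Equiv.sigmaFiberEquiv f).symm, Nat.card_sigma,
      Finset.sum_congr rfl (g := fun _ => ∏ i : Fin k, (Fintype.card F ^ k - Fintype.card F ^ i.val)),
      Finset.sum_const, smul_eq_mul, Finset.card_univ, Nat.card_eq_fintype_card]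
    intro U _
    have : Fintype U.1 := Fintype.ofFinite _
    have h1 := card_linearIndependent (K := F) (V := U.1) (k := k) U.2.ge
    rw [U.2] at h1
    rw [← h1, ← Nat.card_congr (linearIndependentFiberEquiv U.1 U.2)]
    exact Nat.card_congr (Equiv.subtypeEquivRight fun s => by simp [f, Subtype.ext_iff])
  rw [hN] at hfib
  have hfib' := congrArg (Nat.cast : ℕ → ℚ) hfib
  rw [Nat.cast_mul, prod_pow_sub_pow hq hk, prod_pow_sub_pow hq le_rfl] at hfib'
  have h1 : ∏ i ∈ Finset.range k, (Fintype.card F : ℚ) ^ i ≠ 0 :=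
    Finset.prod_ne_zero_iff.2 fun i _ => pow_ne_zero _ (by positivity)
  have h2 : ∏ i ∈ Finset.range k, ((Fintype.card F : ℚ) ^ (k - i) - 1) ≠ 0 :=
    (qFactorial_pos hq k).ne'
  rw [gaussBinom, eq_div_iff h2]
  exact mul_left_cancel₀ h1 (by linear_combination -hfib')

theorem card_submodule_le_finrank_eq [Fintype F] [FiniteDimensional F V] (W : Submodule F V)
    (k : ℕ) :
    (Nat.card {U : Submodule F V // U ≤ W ∧ finrank F U = k} : ℚ) =
      gaussBinom (Fintype.card F) (finrank F W) k := by
  rw [← card_submodule_finrank_eq]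
  congr 1
  refine Nat.card_congr (((Submodule.mapIic W).toEquiv.subtypeEquiv
    (q := fun U : Set.Iic W => finrank F U.1 = k) fun U => ?_).trans
    (Equiv.subtypeSubtypeEquivSubtypeInter (· ∈ Set.Iic W) (finrank F · = k))).symm
  rw [RelIso.coe_fn_toEquiv, Submodule.coe_mapIic_apply, Submodule.finrank_map_subtype_eq]

open scoped Classical in
/-- A function of the dimension, summed over the subspaces of `W`. -/
theorem sum_submodule_le [Fintype F] [FiniteDimensional F V] [Fintype (Submodule F V)]
 (W : Submodule F V) (g : ℕ → ℚ) :
    ∑ U : Submodule F V with U ≤ W, g (finrank F U) =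
      ∑ j ∈ Finset.range (finrank F W + 1), gaussBinom (Fintype.card F) (finrank F W) j * g j := by
  rw [← Finset.sum_fiberwise_of_maps_to (t := Finset.range (finrank F W + 1))
    (g := fun U : Submodule F V => finrank F U)]
  · refine Finset.sum_congr rfl fun j _ => ?_
    rw [Finset.sum_congr rfl (g := fun _ => g j), Finset.sum_const, nsmul_eq_mul,
      ← card_submodule_le_finrank_eq, Nat.card_eq_fintype_card, Fintype.card_subtype,
      Finset.filter_filter]
    intro U hU
    rw [(Finset.mem_filter.1 hU).2]
  · intro U hU
    rw [Finset.mem_range, Nat.lt_succ_iff]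
    exact Submodule.finrank_mono (Finset.mem_filter.1 hU).2

open scoped Classical in
/-- If the sums of `g` over the subspaces of each `W` depend only on the dimension of `W`, then
so does `g`, which is given by Gauss inversion. -/
theorem eq_qInversion_of_sum_le [Fintype F] [FiniteDimensional F V] [Fintype (Submodule F V)]
    (g : Submodule F V → ℚ) (f : ℕ → ℚ)
    (h : ∀ W : Submodule F V, ∑ U with U ≤ W, g U = f (finrank F W)) (W : Submodule F V) :
    g W = qInversion (Fintype.card F) f (finrank F W) := by
  induction hd : finrank F W using Nat.strong_induction_on generalizing W with
  | _ d ih =>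
    subst hd
    have hW : W ∈ ({U : Submodule F V | U ≤ W} : Finset (Submodule F V)) := by simp
    have h1 := h W
    have h2 := sum_submodule_le W (qInversion (Fintype.card F) f)
    -- Both functions have the same sum over the subspaces of `W` and agree on the proper ones by
    -- induction, hence also at `W`.
    rw [sum_gaussBinom_mul_qInversion Fintype.one_lt_card, ← h1,
      ← Finset.add_sum_erase _ _ hW, ← Finset.add_sum_erase _ _ hW,
      Finset.sum_congr rfl (g := g)] at h2
    · exact (add_right_cancel h2).symm
    · intro U hU
      rw [Finset.mem_erase, Finset.mem_filter] at hU
      exact (ih _ (Submodule.finrank_lt_finrank_of_lt (lt_of_le_of_ne hU.2.2 hU.1)) U rfl).symm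

end Count

/-! ### Distances between lifted codewords -/

section LiftDistance

open Module

variable {F : Type*} [Field F] {n : ℕ}

theorem lift_eq_range (A : Matrix (Fin n) (Fin n) F) :
    lift A = LinearMap.range (Matrix.fromCols (1 : Matrix (Fin n) (Fin n) F) A).vecMulLinear :=
  (range_vecMulLinear _).symm

theorem lift'_eq_range (A : Matrix (Fin n) (Fin n) F) :
    lift' A = LinearMap.range (Matrix.fromCols A (1 : Matrix (Fin n) (Fin n) F)).vecMulLinear :=
  (range_vecMulLinear _).symm

theorem mem_lift_iff {A : Matrix (Fin n) (Fin n) F} {u v : Fin n → F} :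
    Sum.elim u v ∈ lift A ↔ v = Matrix.vecMul u A := by
  rw [lift_eq_range, LinearMap.mem_range]
  simp only [Matrix.vecMulLinear_apply, Matrix.vecMul_fromCols, Matrix.vecMul_one, Sum.elim_eq_iff]
  constructor
  · rintro ⟨w, rfl, rfl⟩; rfl
  · rintro rfl; exact ⟨u, rfl, rfl⟩

theorem mem_lift'_iff {A : Matrix (Fin n) (Fin n) F} {u v : Fin n → F} :
    Sum.elim u v ∈ lift' A ↔ u = Matrix.vecMul v A := by
  rw [lift'_eq_range, LinearMap.mem_range]
  simp only [Matrix.vecMulLinear_apply, Matrix.vecMul_fromCols, Matrix.vecMul_one, Sum.elim_eq_iff]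
  constructor
  · rintro ⟨w, rfl, rfl⟩; rfl
  · rintro rfl; exact ⟨v, rfl, rfl⟩

theorem finrank_vecMulLinear_range (A : Matrix (Fin n) (Fin n) F) :
    finrank F (LinearMap.range A.vecMulLinear) = A.rank := by
  rw [range_vecMulLinear, Matrix.rank_eq_finrank_span_row]

theorem vecMulLinear_fromCols_one_injective (A : Matrix (Fin n) (Fin n) F) :
    Function.Injective (Matrix.fromCols (1 : Matrix (Fin n) (Fin n) F) A).vecMulLinear := by
  intro u v h
  simpa [Matrix.vecMul_fromCols, Sum.elim_eq_iff] using congrArg (· ∘ Sum.inl) h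

theorem vecMulLinear_fromCols_one_injective' (A : Matrix (Fin n) (Fin n) F) :
    Function.Injective (Matrix.fromCols A (1 : Matrix (Fin n) (Fin n) F)).vecMulLinear := by
  intro u v h
  simpa [Matrix.vecMul_fromCols, Sum.elim_eq_iff] using congrArg (· ∘ Sum.inr) h

theorem finrank_lift (A : Matrix (Fin n) (Fin n) F) : finrank F (lift A) = n := by
  rw [lift_eq_range, LinearMap.finrank_range_of_inj (vecMulLinear_fromCols_one_injective A)]
  simp

theorem finrank_lift' (A : Matrix (Fin n) (Fin n) F) : finrank F (lift' A) = n := by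
  rw [lift'_eq_range, LinearMap.finrank_range_of_inj (vecMulLinear_fromCols_one_injective' A)]
  simp

theorem lift_injective :
    Function.Injective (lift : Matrix (Fin n) (Fin n) F → Submodule F (Fin n ⊕ Fin n → F)) := by
  intro A B h
  refine Matrix.ext_of_single_vecMul fun i => ?_
  exact mem_lift_iff.1 (h ▸ mem_lift_iff.2 rfl)

theorem lift'_injective :
    Function.Injective (lift' : Matrix (Fin n) (Fin n) F → Submodule F (Fin n ⊕ Fin n → F)) := by
  intro A B h
  refine Matrix.ext_of_single_vecMul fun i => ?_
  exact mem_lift'_iff.1 (h ▸ mem_lift'_iff.2 rfl)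

theorem finrank_ker_vecMulLinear_add_rank (A : Matrix (Fin n) (Fin n) F) :
    finrank F (LinearMap.ker A.vecMulLinear) + A.rank = n := by
  have := LinearMap.finrank_range_add_finrank_ker A.vecMulLinear
  rw [finrank_vecMulLinear_range] at this
  simp only [finrank_fin_fun] at this
  omega

/-- A common vector is `(u, uA) = (u, uB)`, with `u` in the left kernel of `A - B`. -/
theorem finrank_lift_inf_lift (A B : Matrix (Fin n) (Fin n) F) :
    finrank F ↥(lift A ⊓ lift B) + (A - B).rank = n := by
  refine Eq.trans ?_ (finrank_ker_vecMulLinear_add_rank (A - B))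
  suffices h : lift A ⊓ lift B =
      (LinearMap.ker (A - B).vecMulLinear).map
        (Matrix.fromCols (1 : Matrix (Fin n) (Fin n) F) A).vecMulLinear by
    rw [h, ← (Submodule.equivMapOfInjective _ (vecMulLinear_fromCols_one_injective A) _).finrank_eq]
  ext x
  obtain ⟨u, v, rfl⟩ : ∃ u v, x = Sum.elim u v := ⟨x ∘ Sum.inl, x ∘ Sum.inr, by simp⟩
  simp only [Submodule.mem_inf, mem_lift_iff, Submodule.mem_map, LinearMap.mem_ker,
    Matrix.vecMulLinear_apply, Matrix.vecMul_fromCols, Matrix.vecMul_one, Sum.elim_eq_iff,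
    Matrix.vecMul_sub, sub_eq_zero]
  constructor
  · rintro ⟨h1, h2⟩; exact ⟨u, h1 ▸ h2, rfl, h1.symm⟩
  · rintro ⟨w, h1, rfl, rfl⟩; exact ⟨rfl, h1⟩

theorem finrank_lift'_inf_lift' (A B : Matrix (Fin n) (Fin n) F) :
    finrank F ↥(lift' A ⊓ lift' B) + (A - B).rank = n := by
  refine Eq.trans ?_ (finrank_ker_vecMulLinear_add_rank (A - B))
  suffices h : lift' A ⊓ lift' B =
      (LinearMap.ker (A - B).vecMulLinear).map
        (Matrix.fromCols A (1 : Matrix (Fin n) (Fin n) F)).vecMulLinear by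
    rw [h, ← (Submodule.equivMapOfInjective _ (vecMulLinear_fromCols_one_injective' A) _).finrank_eq]
  ext x
  obtain ⟨u, v, rfl⟩ : ∃ u v, x = Sum.elim u v := ⟨x ∘ Sum.inl, x ∘ Sum.inr, by simp⟩
  simp only [Submodule.mem_inf, mem_lift'_iff, Submodule.mem_map, LinearMap.mem_ker,
    Matrix.vecMulLinear_apply, Matrix.vecMul_fromCols, Matrix.vecMul_one, Sum.elim_eq_iff,
    Matrix.vecMul_sub, sub_eq_zero]
  constructor
  · rintro ⟨h1, h2⟩; exact ⟨v, h1 ▸ h2, h1.symm, rfl⟩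
  · rintro ⟨w, h1, rfl, rfl⟩; exact ⟨rfl, h1⟩

/-- A common vector has the form `(u, uA)` with `u = vB`, so it is determined by an element `u` of
the row space of `B`. -/
theorem finrank_lift_inf_lift'_le (A B : Matrix (Fin n) (Fin n) F) :
    finrank F ↥(lift A ⊓ lift' B) ≤ B.rank := by
  rw [← finrank_vecMulLinear_range,
    (Submodule.equivMapOfInjective _ (vecMulLinear_fromCols_one_injective A) _).finrank_eq]
  refine Submodule.finrank_mono fun x hx => ?_
  obtain ⟨u, v, rfl⟩ : ∃ u v, x = Sum.elim u v := ⟨x ∘ Sum.inl, x ∘ Sum.inr, by simp⟩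
  rw [Submodule.mem_inf, mem_lift_iff, mem_lift'_iff] at hx
  refine ⟨u, ⟨v, hx.2.symm⟩, ?_⟩
  rw [Matrix.vecMulLinear_apply, Matrix.vecMul_fromCols, Matrix.vecMul_one, ← hx.1]

theorem subspaceDist_add_of_finrank {V : Type*} [AddCommGroup V] [Module F V]
    [FiniteDimensional F V] {U W : Submodule F V} (hU : finrank F U = n) (hW : finrank F W = n) :
    subspaceDist U W + 2 * finrank F ↥(U ⊓ W) = 2 * n := by
  have h1 := Submodule.finrank_sup_add_finrank_inf_eq U W
  have h2 : finrank F ↥(U ⊓ W) ≤ finrank F ↥(U ⊔ W) :=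
    Submodule.finrank_mono (inf_le_left.trans le_sup_left)
  unfold subspaceDist
  omega

theorem subspaceDist_comm {V : Type*} [AddCommGroup V] [Module F V] (U W : Submodule F V) :
    subspaceDist U W = subspaceDist W U := by
  rw [subspaceDist, subspaceDist, sup_comm, inf_comm]

theorem subspaceDist_lift_lift (A B : Matrix (Fin n) (Fin n) F) :
    subspaceDist (lift A) (lift B) = 2 * (A - B).rank := by
  have h1 := subspaceDist_add_of_finrank (finrank_lift A) (finrank_lift B)
  have h2 := finrank_lift_inf_lift A B
  omega

theorem subspaceDist_lift'_lift' (A B : Matrix (Fin n) (Fin n) F) :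
    subspaceDist (lift' A) (lift' B) = 2 * (A - B).rank := by
  have h1 := subspaceDist_add_of_finrank (finrank_lift' A) (finrank_lift' B)
  have h2 := finrank_lift'_inf_lift' A B
  omega

theorem le_subspaceDist_lift_lift' (A B : Matrix (Fin n) (Fin n) F) :
    2 * n ≤ subspaceDist (lift A) (lift' B) + 2 * B.rank := by
  have h1 := subspaceDist_add_of_finrank (finrank_lift A) (finrank_lift' B)
  have h2 := finrank_lift_inf_lift'_le A B
  omega

end LiftDistance

/-! ### The rank distribution of a linear MRD code with minimum distance two -/

section RankDistribution

open Module

variable {F : Type*} [Field F] {n : ℕ}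

/-- The matrices with all rows in `U`. -/
def rowsIn (U : Submodule F (Fin n → F)) : Submodule F (Matrix (Fin n) (Fin n) F) where
  carrier := {A | ∀ i, A i ∈ U}
  zero_mem' _ := U.zero_mem
  add_mem' hA hB i := U.add_mem (hA i) (hB i)
  smul_mem' c _ hA i := U.smul_mem c (hA i)

theorem mem_rowsIn_iff {U : Submodule F (Fin n → F)} {A : Matrix (Fin n) (Fin n) F} :
    A ∈ rowsIn U ↔ Submodule.span F (Set.range A.row) ≤ U := by
  rw [Submodule.span_le]
  exact ⟨fun h => by rintro _ ⟨i, rfl⟩; exact h i, fun h i => h ⟨i, rfl⟩⟩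

/-- A matrix with rows in `U` is a family of vectors of `U`. -/
def rowsInEquiv (U : Submodule F (Fin n → F)) : rowsIn U ≃ₗ[F] (Fin n → U) where
  toFun A i := ⟨A.1 i, A.2 i⟩
  invFun s := ⟨fun i => s i, fun i => (s i).2⟩
  map_add' _ _ := rfl
  map_smul' _ _ := rfl
  left_inv _ := rfl
  right_inv _ := rfl

theorem finrank_rowsIn (U : Submodule F (Fin n → F)) :
    finrank F (rowsIn U) = n * finrank F U := by
  rw [(rowsInEquiv U).finrank_eq, Module.finrank_pi_fintype]
  simp

theorem rowsIn_mono {U W : Submodule F (Fin n → F)} (h : U ≤ W) : rowsIn U ≤ rowsIn W :=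
  fun _ hA i => h (hA i)

variable {M : Submodule F (Matrix (Fin n) (Fin n) F)}

/-- The code has codimension `n`, which bounds the dimension from below. The matrices with all rows
on one line of `U` form an `n`-dimensional space of rank at most one, so it meets the code
trivially; this bounds the dimension from above. Truncated subtraction covers `U = 0`. -/
theorem finrank_inf_rowsIn (hdim : finrank F M = n * (n - 1))
    (hrank : ∀ A ∈ M, A ≠ 0 → 2 ≤ A.rank) (U : Submodule F (Fin n → F)) :
    finrank F ↥(M ⊓ rowsIn U) = n * (finrank F U - 1) := by
  have hle : finrank F ↥(M ⊓ rowsIn U) ≤ finrank F (rowsIn U) := Submodule.finrank_mono inf_le_right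
  rw [finrank_rowsIn] at hle
  rcases Nat.eq_zero_or_pos (finrank F U) with h0 | h0
  · rw [h0] at hle ⊢
    simpa using hle
  · have hlow : n * finrank F U + n * (n - 1) ≤ finrank F ↥(M ⊓ rowsIn U) + n * n := by
      have h1 := Submodule.finrank_sup_add_finrank_inf_eq M (rowsIn U)
      have h2 := Submodule.finrank_le (M ⊔ rowsIn U)
      rw [Module.finrank_matrix] at h2
      simp only [Fintype.card_fin, finrank_self, mul_one] at h2
      rw [hdim, finrank_rowsIn] at h1
      omega
    have hup : finrank F ↥(M ⊓ rowsIn U) + n ≤ n * finrank F U := by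
      obtain ⟨⟨x, hxU⟩, hx⟩ := Module.finrank_pos_iff_exists_ne_zero.1 h0
      have hx0 : x ≠ 0 := fun h => hx (Subtype.ext h)
      have hL : F ∙ x ≤ U := by simpa using hxU
      have hdisj : (M ⊓ rowsIn U) ⊓ rowsIn (F ∙ x) = ⊥ := by
        rw [eq_bot_iff]
        rintro A ⟨⟨hAM, -⟩, hA⟩
        by_contra hA0
        have h1 := hrank A hAM hA0
        have h2 := Submodule.finrank_mono (mem_rowsIn_iff.1 hA)
        rw [← Matrix.rank_eq_finrank_span_row, finrank_span_singleton hx0] at h2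
        omega
      have h1 := Submodule.finrank_sup_add_finrank_inf_eq (M ⊓ rowsIn U) (rowsIn (F ∙ x))
      have h2 : finrank F ↥((M ⊓ rowsIn U) ⊔ rowsIn (F ∙ x)) ≤ finrank F (rowsIn U) :=
        Submodule.finrank_mono (sup_le inf_le_right (rowsIn_mono hL))
      rw [hdisj, finrank_bot, finrank_rowsIn, finrank_span_singleton hx0] at h1
      rw [finrank_rowsIn] at h2
      omega
    have e1 : n * (n - 1) + n = n * n := by
      rcases n with _ | n
      · simp
      · simp [Nat.mul_succ]
    have e2 : n * (finrank F U - 1) + n = n * finrank F U := by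
      obtain ⟨k, hk⟩ := Nat.exists_eq_succ_of_ne_zero h0.ne'
      rw [hk]
      simp [Nat.mul_succ]
    omega

/-- Subtracting the vanishing inversion of `1` replaces the power by the power minus `1`; then the
terms `j = 0, 1` drop out, since `j - 1 = 0` for both. -/
theorem qInversion_pow {q : ℕ} (hq : 2 ≤ q) (n : ℕ) {r : ℕ} (hr : r ≠ 0) :
    qInversion q (fun j => (q : ℚ) ^ (n * (j - 1))) r =
      ∑ j ∈ Finset.Icc 2 r, (-1 : ℚ) ^ (r - j) * gaussBinom q r j *
        (q : ℚ) ^ (r - j).choose 2 * ((q : ℚ) ^ (n * (j - 1)) - 1) := by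
  rw [← sub_zero (qInversion _ _ _), ← alternating_sum_gaussBinom_reflect hq hr, qInversion,
    ← Finset.sum_sub_distrib]
  symm
  refine Finset.sum_subset_zero_on_sdiff ?_ ?_ ?_
  · intro j hj
    rw [Finset.mem_Icc] at hj
    rw [Finset.mem_range]
    omega
  · intro j hj
    rw [Finset.mem_sdiff, Finset.mem_Icc, Finset.mem_range] at hj
    rw [show j - 1 = 0 by omega]
    simp
  · intro j _
    ring

/-- The number of codewords of rank `r`. -/
theorem ncard_rankPart [Fintype F] (hdim : finrank F M = n * (n - 1))
    (hrank : ∀ A ∈ M, A ≠ 0 → 2 ≤ A.rank) (r : ℕ) :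
    ((rankPart (M : Set (Matrix (Fin n) (Fin n) F)) r).ncard : ℚ) =
      gaussBinom (Fintype.card F) n r *
        qInversion (Fintype.card F) (fun j => (Fintype.card F : ℚ) ^ (n * (j - 1))) r := by
  classical
  have : Fintype (Submodule F (Fin n → F)) := Fintype.ofFinite _
  let R : Matrix (Fin n) (Fin n) F → Submodule F (Fin n → F) :=
    fun A => Submodule.span F (Set.range A.row)
  let g : Submodule F (Fin n → F) → ℚ := fun U =>
    (Finset.card {A : Matrix (Fin n) (Fin n) F | A ∈ M ∧ R A = U} : ℕ)
  have hfib (p : Submodule F (Fin n → F) → Prop) [DecidablePred p] :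
      ∑ U with p U, g U = (Finset.card {A : Matrix (Fin n) (Fin n) F | A ∈ M ∧ p (R A)} : ℕ) := by
    rw [Finset.card_eq_sum_card_fiberwise (f := R) (t := {U | p U}), Nat.cast_sum]
    · refine Finset.sum_congr rfl fun U hU => ?_
      rw [Finset.filter_filter]
      refine congrArg (fun s : Finset _ => (s.card : ℚ)) (Finset.ext fun A => ?_)
      simp only [Finset.mem_filter, Finset.mem_univ, true_and] at hU ⊢
      constructor
      · rintro ⟨h1, rfl⟩; exact ⟨⟨h1, hU⟩, rfl⟩
      · rintro ⟨⟨h1, -⟩, h2⟩; exact ⟨h1, h2⟩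
    · intro A hA
      simpa using (Finset.mem_filter.1 hA).2.2
  -- Summing `g` below `W` counts `M ⊓ rowsIn W`, whose size depends only on `dim W`.
  have hg := eq_qInversion_of_sum_le g (fun j => (Fintype.card F : ℚ) ^ (n * (j - 1))) (by
    intro W
    rw [hfib (· ≤ W), ← finrank_inf_rowsIn hdim hrank W, ← Nat.cast_pow,
      ← Nat.card_eq_fintype_card (α := F), ← Module.natCard_eq_pow_finrank,
      ← Fintype.card_subtype, ← Nat.card_eq_fintype_card]
    congr 1
    exact Nat.card_congr (Equiv.subtypeEquivRight fun A => by
      rw [Submodule.mem_inf, mem_rowsIn_iff]))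
  have h1 : (rankPart (M : Set (Matrix (Fin n) (Fin n) F)) r).ncard =
      Finset.card {A : Matrix (Fin n) (Fin n) F | A ∈ M ∧ finrank F (R A) = r} := by
    rw [← Set.ncard_coe_finset]
    congr 1
    ext A
    simp [rankPart, R, Matrix.rank_eq_finrank_span_row]
  rw [h1]
  refine (hfib (finrank F · = r)).symm.trans ?_
  rw [Finset.sum_congr rfl (g := fun _ =>
    qInversion (Fintype.card F) (fun j => (Fintype.card F : ℚ) ^ (n * (j - 1))) r),
    Finset.sum_const, nsmul_eq_mul, ← Fintype.card_subtype, ← Nat.card_eq_fintype_card,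
    card_submodule_finrank_eq, finrank_fin_fun]
  intro U hU
  rw [hg, (Finset.mem_filter.1 hU).2]

/-! ### The union of the lifted codes -/

variable [Fintype F]

theorem ncard_liftedUnion (hdim : finrank F M = n * (n - 1))
    (hrank : ∀ A ∈ M, A ≠ 0 → 2 ≤ A.rank) (hn : 4 ≤ n) :
    ((liftedUnion (M : Set (Matrix (Fin n) (Fin n) F))).ncard : ℚ) =
      codeSize (Fintype.card F) n := by
  have hdisj : Disjoint (lift '' (M : Set (Matrix (Fin n) (Fin n) F)))
      (⋃ r ∈ Finset.Icc 2 (n - 2), lift' '' rankPart (M : Set (Matrix (Fin n) (Fin n) F)) r) := by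
    rw [Set.disjoint_left]
    rintro _ ⟨A, -, rfl⟩ hB
    simp only [Set.mem_iUnion, Finset.mem_Icc] at hB
    obtain ⟨r, hr, B, ⟨-, hBr⟩, hAB⟩ := hB
    -- If `L(A) = L'(B)`, the intersection has dimension `n`, yet at most `rank B ≤ n - 2`.
    have h := finrank_lift_inf_lift'_le A B
    rw [hAB, inf_idem, finrank_lift] at h
    omega
  have hpart : (⋃ r ∈ Finset.Icc 2 (n - 2),
      lift' '' rankPart (M : Set (Matrix (Fin n) (Fin n) F)) r).ncard =
      ∑ r ∈ Finset.Icc 2 (n - 2), (rankPart (M : Set (Matrix (Fin n) (Fin n) F)) r).ncard := by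
    have h := (Finset.Icc 2 (n - 2)).finite_toSet.ncard_biUnion
      (s := fun r => lift' '' rankPart (M : Set (Matrix (Fin n) (Fin n) F)) r)
      (fun r _ => Set.toFinite _) (by
        intro r _ s _ hrs
        rw [Function.onFun, Set.disjoint_image_iff lift'_injective, Set.disjoint_left]
        rintro A ⟨-, h1⟩ ⟨-, h2⟩
        exact hrs (h1.symm.trans h2))
    rw [finsum_mem_coe_finset] at h
    refine h.trans (Finset.sum_congr rfl fun r _ => ?_)
    exact Set.ncard_image_of_injective _ lift'_injective
  rw [liftedUnion, Set.ncard_union_eq hdisj (Set.toFinite _) (Set.toFinite _), hpart,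
    Set.ncard_image_of_injective _ lift_injective, codeSize, Nat.cast_add, Nat.cast_sum]
  congr 1
  · rw [← Nat.card_coe_set_eq]
    change (Nat.card M : ℚ) = _
    rw [Module.natCard_eq_pow_finrank (K := F), hdim, Nat.card_eq_fintype_card, Nat.mul_sub, sq]
    simp
  · refine Finset.sum_congr rfl fun r hr => ?_
    rw [ncard_rankPart hdim hrank,
      qInversion_pow Fintype.one_lt_card n (by have := Finset.mem_Icc.1 hr; omega)]

theorem isConstantDimensionCode_liftedUnion (hrank : ∀ A ∈ M, A ≠ 0 → 2 ≤ A.rank) (hex : ∃ A ∈ M, A.rank = 2) (hn : 4 ≤ n) :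
    IsConstantDimensionCode (2 * n) (liftedUnion (M : Set (Matrix (Fin n) (Fin n) F))).ncard 4 n
      (liftedUnion (M : Set (Matrix (Fin n) (Fin n) F))) := by
  have hmem : ∀ U ∈ liftedUnion (M : Set (Matrix (Fin n) (Fin n) F)),
      (∃ A ∈ M, U = lift A) ∨ ∃ A ∈ M, A.rank ≤ n - 2 ∧ U = lift' A := by
    rintro U (⟨A, hA, rfl⟩ | hU)
    · exact Or.inl ⟨A, hA, rfl⟩
    · simp only [Set.mem_iUnion, Finset.mem_Icc] at hU
      obtain ⟨r, hr, A, ⟨hA, rfl⟩, rfl⟩ := hU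
      exact Or.inr ⟨A, hA, hr.2, rfl⟩
  refine ⟨?_, Set.toFinite _, rfl, ?_, ?_, ?_⟩
  · simp [two_mul]
  · intro U hU
    rcases hmem U hU with ⟨A, -, rfl⟩ | ⟨A, -, -, rfl⟩
    · exact finrank_lift A
    · exact finrank_lift' A
  · obtain ⟨A, hA, hA2⟩ := hex
    refine ⟨lift A, Or.inl ⟨A, hA, rfl⟩, lift 0, Or.inl ⟨0, M.zero_mem, rfl⟩, ?_, ?_⟩
    · intro h
      rw [lift_injective h, Matrix.rank_zero] at hA2
      omega
    · rw [subspaceDist_lift_lift, sub_zero, hA2]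
  · rintro _ ⟨U, hU, W, hW, hUW, rfl⟩
    rcases hmem U hU with ⟨A, hA, rfl⟩ | ⟨A, hA, hAr, rfl⟩ <;>
      rcases hmem W hW with ⟨B, hB, rfl⟩ | ⟨B, hB, hBr, rfl⟩
    · have := hrank _ (M.sub_mem hA hB) (sub_ne_zero.2 fun h => hUW (h ▸ rfl))
      rw [subspaceDist_lift_lift]
      omega
    · have := le_subspaceDist_lift_lift' A B
      omega
    · have := le_subspaceDist_lift_lift' B A
      rw [subspaceDist_comm]
      omega
    · have := hrank _ (M.sub_mem hA hB) (sub_ne_zero.2 fun h => hUW (h ▸ rfl))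
      rw [subspaceDist_lift'_lift']
      omega

theorem exists_isConstantDimensionCode (hn : 4 ≤ n)
    (hM : IsMRD (n - 1) (M : Set (Matrix (Fin n) (Fin n) F))) :
    ∃ N : ℕ, (N : ℚ) = codeSize (Fintype.card F) n ∧
      IsConstantDimensionCode (2 * n) N 4 n
        (liftedUnion (M : Set (Matrix (Fin n) (Fin n) F))) := by
  obtain ⟨-, -, ⟨⟨A, hA, B, hB, -, hAB⟩, hmin⟩, hcard⟩ := hM
  rw [min_self, show n - (n - 1) + 1 = 2 by omega] at hmin hAB
  have hrank : ∀ A ∈ M, A ≠ 0 → 2 ≤ A.rank := fun A hA hA0 =>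
    hmin ⟨A, hA, 0, M.zero_mem, hA0, by rw [sub_zero]⟩
  have hdim : finrank F M = n * (n - 1) := by
    have h : Nat.card M = Fintype.card F ^ (max n n * (n - 1)) := hcard
    rw [Module.natCard_eq_pow_finrank (K := F), Nat.card_eq_fintype_card, max_self] at h
    exact Nat.pow_right_injective Fintype.one_lt_card h
  -- By linearity, the difference of two codewords at minimum distance is a codeword of rank `2`.
  exact ⟨_, ncard_liftedUnion hdim hrank hn,
    isConstantDimensionCode_liftedUnion hrank ⟨A - B, M.sub_mem hA hB, hAB.symm⟩ hn⟩

end RankDistribution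

/-! ### The code of a Singer cycle -/

section QuadEval

open Module

variable {F K : Type*} [Field F] [Field K] [Algebra F K] {n : ℕ}

/-- The quadratic form of a matrix over `F` at a vector over `K`, as a linear function of the
matrix. -/
def quadEval (F : Type*) [Field F] [Algebra F K] (x : Fin n → K) :
    Matrix (Fin n) (Fin n) F →ₗ[F] K where
  toFun A := ∑ i, ∑ j, A i j • (x i * x j)
  map_add' A B := by simp [add_smul, Finset.sum_add_distrib]
  map_smul' c A := by simp [Finset.smul_sum, mul_smul]

theorem quadEval_apply (x : Fin n → K) (A : Matrix (Fin n) (Fin n) F) :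
    quadEval F x A = ∑ i, ∑ j, A i j • (x i * x j) := rfl

theorem mul_map_mul_transpose_diag (X : Matrix (Fin n) (Fin n) K) (A : Matrix (Fin n) (Fin n) F)
    (i : Fin n) : (X * A.map (algebraMap F K) * X.transpose) i i = quadEval F (X i) A := by
  rw [quadEval_apply, Matrix.mul_apply, Finset.sum_comm]
  refine Finset.sum_congr rfl fun j _ => ?_
  rw [Matrix.mul_apply, Finset.sum_mul]
  refine Finset.sum_congr rfl fun k _ => ?_
  rw [Algebra.smul_def, Matrix.map_apply, Matrix.transpose_apply]
  ring

theorem quadEval_smul (c : K) (x : Fin n → K) (A : Matrix (Fin n) (Fin n) F) :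
    quadEval F (c • x) A = c ^ 2 * quadEval F x A := by
  simp only [quadEval_apply, Finset.mul_sum, Pi.smul_apply, smul_eq_mul]
  simp only [Algebra.smul_def]
  exact Finset.sum_congr rfl fun i _ => Finset.sum_congr rfl fun j _ => by ring

theorem quadEval_algHom (σ : K →ₐ[F] K) (x : Fin n → K) (A : Matrix (Fin n) (Fin n) F) :
    quadEval F (fun i => σ (x i)) A = σ (quadEval F x A) := by
  simp [quadEval_apply]

/-- The terms at `(i, j)` and `(j, i)` cancel and the diagonal terms are zero, so the characteristic
plays no role. -/
theorem skewMatrices_le_ker_quadEval (x : Fin n → K) :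
    skewMatrices F n ≤ LinearMap.ker (quadEval F x) := by
  rintro A ⟨hA, hA0⟩
  rw [LinearMap.mem_ker, quadEval_apply, ← Finset.sum_product']
  refine Finset.sum_involution (fun p _ => (p.2, p.1)) ?_ ?_ ?_ ?_
  · rintro ⟨i, j⟩ -
    have : A j i = -A i j := congrFun (congrFun hA i) j
    simp only
    rw [this, neg_smul, mul_comm, add_neg_cancel]
  · rintro ⟨i, j⟩ - h hij
    obtain rfl : j = i := congrArg Prod.fst hij
    exact h (by simp [hA0])
  · simp
  · simp

/-- On a matrix `c vᵀ` the form factors as `(∑ c i • x i) * (∑ v j • x j)`; in a field one factor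
vanishes, and independence gives `c = 0` or `v = 0`. -/
theorem two_le_rank_of_quadEval_eq_zero {x : Fin n → K} (hx : LinearIndependent F x)
    {A : Matrix (Fin n) (Fin n) F} (hA : quadEval F x A = 0) (hA0 : A ≠ 0) : 2 ≤ A.rank := by
  by_contra hlt
  have h1 : finrank F (Submodule.span F (Set.range A.row)) ≤ 1 := by
    rw [← Matrix.rank_eq_finrank_span_row]
    omega
  obtain ⟨⟨v, hvA⟩, hv⟩ := finrank_le_one_iff.1 h1
  have hrow (i : Fin n) : ∃ c : F, c • v = A i := by
    obtain ⟨c, hc⟩ := hv ⟨A i, Submodule.subset_span ⟨i, rfl⟩⟩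
    exact ⟨c, congrArg Subtype.val hc⟩
  choose c hc using hrow
  have hprod : quadEval F x A = (∑ i, c i • x i) * ∑ j, v j • x j := by
    rw [quadEval_apply, Finset.sum_mul_sum]
    refine Finset.sum_congr rfl fun i _ => Finset.sum_congr rfl fun j _ => ?_
    rw [← hc i, Pi.smul_apply, smul_eq_mul, smul_mul_smul_comm]
  rw [hprod, mul_eq_zero] at hA
  rw [Fintype.linearIndependent_iff] at hx
  apply hA0
  ext i j
  rw [← hc i]
  rcases hA with h | h
  · simp [hx c h i]
  · simp [hx v h j]

/-- Such a matrix shows that the minimum distance `2` is attained. -/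
theorem exists_mem_skewMatrices_rank_le_two (hn : 2 ≤ n) :
    ∃ A ∈ skewMatrices F n, A ≠ 0 ∧ A.rank ≤ 2 := by
  let i : Fin n := ⟨0, by omega⟩
  let j : Fin n := ⟨1, by omega⟩
  have hij : i ≠ j := by simp [i, j]
  refine ⟨Matrix.vecMulVec (Pi.single i 1) (Pi.single j 1) -
    Matrix.vecMulVec (Pi.single j 1) (Pi.single i 1), ⟨?_, ?_⟩, ?_, ?_⟩
  · rw [Matrix.transpose_sub, Matrix.transpose_vecMulVec, Matrix.transpose_vecMulVec, neg_sub]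
  · intro k
    simp [Matrix.vecMulVec_apply, mul_comm]
  · intro h
    have := congrFun (congrFun h i) j
    simp [Matrix.vecMulVec_apply, hij] at this
  · rw [Matrix.rank_eq_finrank_span_row]
    refine (Submodule.finrank_mono (Submodule.span_le.2 ?_)).trans
      (finrank_range_le_card (R := F) ![(Pi.single i 1 : Fin n → F), Pi.single j 1])
    rintro _ ⟨k, rfl⟩
    rw [Matrix.range_cons_cons_empty, SetLike.mem_coe, Submodule.mem_span_pair]
    refine ⟨-(Pi.single j 1 : Fin n → F) k, (Pi.single i 1 : Fin n → F) k, ?_⟩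
    ext l
    simp [Matrix.vecMulVec_apply]
    ring

theorem finrank_ker_quadEval (hn : n ≠ 0) (hK : finrank F K = n) {x : Fin n → K}
    (hx : LinearIndependent F x) : finrank F (LinearMap.ker (quadEval F x)) = n * (n - 1) := by
  have : FiniteDimensional F K := FiniteDimensional.of_finrank_pos (by omega)
  have : Nonempty (Fin n) := ⟨⟨0, by omega⟩⟩
  let i₀ : Fin n := ⟨0, by omega⟩
  let b := basisOfLinearIndependentOfCardEqFinrank hx (by simp [hK])
  have hsurj : LinearMap.range (quadEval F x) = ⊤ := by
    rw [LinearMap.range_eq_top]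
    intro y
    -- A single nonzero row suffices: it holds the coordinates of `(x i₀)⁻¹ * y`, and the form
    -- multiplies their combination by `x i₀`.
    refine ⟨Matrix.of fun i j => if i = i₀ then b.repr ((x i₀)⁻¹ * y) j else 0, ?_⟩
    rw [quadEval_apply, Finset.sum_eq_single i₀]
    · have h := b.sum_repr ((x i₀)⁻¹ * y)
      simp only [b, coe_basisOfLinearIndependentOfCardEqFinrank] at h
      simp only [Matrix.of_apply, if_true, ← mul_smul_comm, ← Finset.mul_sum]
      rw [h, mul_inv_cancel_left₀ (hx.ne_zero i₀)]
    · intro i _ hi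
      simp [hi]
    · simp
  have h := LinearMap.finrank_range_add_finrank_ker (quadEval F x)
  rw [hsurj, finrank_top, hK, Module.finrank_matrix] at h
  simp only [Fintype.card_fin, finrank_self, mul_one] at h
  rw [Nat.mul_sub]
  omega

end QuadEval

/-! ### Singer cycles, their eigenvectors, and the MRD property -/

section SingerCode

open Module FiniteField

variable {F K : Type*} [Field F] [Fintype F] [Field K] [Algebra F K] {n : ℕ}

theorem frobeniusAlgHom_pow_apply (k : ℕ) (x : K) :
    (frobeniusAlgHom F K ^ k) x = x ^ Fintype.card F ^ k := by
  rw [AlgHom.coe_pow, coe_frobeniusAlgHom, pow_iterate]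

/-- The powers `ω ^ q ^ i`, `i < n`, of a primitive element are distinct. -/
theorem pow_card_pow_injective (hn : n ≠ 0) (hK : finrank F K = n) {ω : K}
    (hω : ∀ x : K, x ≠ 0 → ∃ k : ℕ, x = ω ^ k) :
    Function.Injective fun i : Fin n => ω ^ Fintype.card F ^ (i : ℕ) := by
  have : FiniteDimensional F K := FiniteDimensional.of_finrank_pos (by omega)
  have : Finite K := Module.finite_of_finite F
  intro i j hij
  -- Two Frobenius powers that agree at the generator `ω` are equal, and the Frobenius map has order
  -- `n`.
  have h : frobeniusAlgHom F K ^ (i : ℕ) = frobeniusAlgHom F K ^ (j : ℕ) := by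
    ext x
    rw [frobeniusAlgHom_pow_apply, frobeniusAlgHom_pow_apply]
    rcases eq_or_ne x 0 with rfl | hx
    · simp [Fintype.card_ne_zero]
    · obtain ⟨k, rfl⟩ := hω x hx
      have : ω ^ Fintype.card F ^ (i : ℕ) = ω ^ Fintype.card F ^ (j : ℕ) := hij
      rw [pow_right_comm, this, pow_right_comm]
  refine Fin.ext (pow_injOn_Iio_orderOf ?_ ?_ h) <;>
  · rw [orderOf_frobeniusAlgHom, hK]
    exact Fin.is_lt _

theorem exists_primitive_pow (hn : n ≠ 0) (hK : finrank F K = n) :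
    ∃ ω : K, ω ≠ 0 ∧ ∀ x : K, x ≠ 0 → ∃ k : ℕ, x = ω ^ k := by
  have : FiniteDimensional F K := FiniteDimensional.of_finrank_pos (by omega)
  have : Finite K := Module.finite_of_finite F
  obtain ⟨g, hg⟩ := IsCyclic.exists_monoid_generator (α := Kˣ)
  refine ⟨g, g.ne_zero, fun x hx => ?_⟩
  obtain ⟨k, hk⟩ := hg (Units.mk0 x hx)
  exact ⟨k, by simpa using (congrArg Units.val hk).symm⟩

/-- `C` is the transposed matrix of multiplication by `ω` in a basis `b`, so the vector of basis
elements is an eigenvector for `ω`. Its Frobenius conjugates, the columns of `E`, have distinct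
eigenvalues and are therefore independent. -/
theorem exists_isSingerDiagonalization (hn : n ≠ 0) (hK : finrank F K = n) :
    ∃ (ω : K) (C : Matrix (Fin n) (Fin n) F) (E : Matrix (Fin n) (Fin n) K),
      IsSingerDiagonalization ω C E := by
  have : FiniteDimensional F K := FiniteDimensional.of_finrank_pos (by omega)
  obtain ⟨ω, hω0, hω⟩ := exists_primitive_pow hn hK
  let b : Basis (Fin n) F K := finBasisOfFinrankEq F K hK
  let C : Matrix (Fin n) (Fin n) F := (Algebra.leftMulMatrix b ω).transpose
  let E : Matrix (Fin n) (Fin n) K := Matrix.of fun i k => b i ^ Fintype.card F ^ (k : ℕ)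
  have hmul (k j : Fin n) : ∑ i, algebraMap F K (C j i) * E i k =
      ω ^ Fintype.card F ^ (k : ℕ) * E j k := by
    have h : ∑ i, C j i • b i = ω * b j := by
      rw [← b.sum_repr (ω * b j)]
      simp [C, Algebra.leftMulMatrix_eq_repr_mul]
    have := congrArg (frobeniusAlgHom F K ^ (k : ℕ)) h
    rw [map_sum, map_mul] at this
    simp only [map_smul] at this
    simp only [Algebra.smul_def, frobeniusAlgHom_pow_apply] at this
    exact this
  have hCE : C.map (algebraMap F K) * E =
      E * Matrix.diagonal fun i : Fin n => ω ^ Fintype.card F ^ (i : ℕ) := by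
    ext j k
    rw [Matrix.mul_diagonal, mul_comm, ← hmul, Matrix.mul_apply]
    rfl
  have hdet : IsUnit E.det := by
    rw [← Matrix.isUnit_iff_isUnit_det, ← Matrix.linearIndependent_cols_iff_isUnit]
    refine Module.End.eigenvectors_linearIndependent' (C.map (algebraMap F K)).mulVecLin _
      (pow_card_pow_injective hn hK hω) _ fun k => ⟨?_, ?_⟩
    · rw [Module.End.mem_eigenspace_iff]
      ext j
      simpa [Matrix.mulVec, dotProduct] using hmul k j
    · intro h
      have := congrFun h ⟨0, by omega⟩
      exact pow_ne_zero _ (b.ne_zero _) this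
  refine ⟨ω, C, E, hK, ⟨hω0, hω⟩, hdet, ?_⟩
  rw [Matrix.mul_assoc, hCE, ← Matrix.mul_assoc, Matrix.nonsing_inv_mul _ hdet, Matrix.one_mul]

/-- In a Singer diagonalization, the rows of `E⁻¹` are up to scalars the conjugates of a vector
whose entries form a basis of `K` over `F`. -/
theorem IsSingerDiagonalization.exists_linearIndependent (hn : n ≠ 0) {ω : K}
    {C : Matrix (Fin n) (Fin n) F} {E : Matrix (Fin n) (Fin n) K}
    (h : IsSingerDiagonalization ω C E) :
    ∃ x : Fin n → K, LinearIndependent F x ∧ singerCode F E = LinearMap.ker (quadEval F x) := by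
  obtain ⟨hK, ⟨-, hω⟩, hdet, hdiag⟩ := h
  have hinj := pow_card_pow_injective hn hK hω
  set D : Matrix (Fin n) (Fin n) K :=
    Matrix.diagonal fun i : Fin n => ω ^ Fintype.card F ^ (i : ℕ) with hD
  have hXE := Matrix.nonsing_inv_mul _ hdet
  have hEX := Matrix.mul_nonsing_inv _ hdet
  have hXC : E⁻¹ * C.map (algebraMap F K) = D * E⁻¹ := by
    rw [← hdiag, Matrix.mul_assoc _ E, hEX, Matrix.mul_one]
  have hCE : C.map (algebraMap F K) * E = E * D := by
    rw [← hdiag, ← Matrix.mul_assoc, ← Matrix.mul_assoc, hEX, Matrix.one_mul]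
  let i₀ : Fin n := ⟨0, by omega⟩
  let x : Fin n → K := E⁻¹ i₀
  let y : Fin n → Fin n → K := fun i j => (frobeniusAlgHom F K ^ (i : ℕ)) (x j)
  have hxC (j : Fin n) : ∑ k, x k * algebraMap F K (C k j) = ω * x j := by
    have := congrFun (congrFun hXC i₀) j
    rw [hD, Matrix.diagonal_mul, Matrix.mul_apply] at this
    simpa [i₀] using this
  -- Frobenius fixes the entries of `C`, so it carries left eigenvectors to left eigenvectors with
  -- conjugate eigenvalue.
  have hyC (i : Fin n) : Matrix.vecMul (y i) (C.map (algebraMap F K)) =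
      ω ^ Fintype.card F ^ (i : ℕ) • y i := by
    ext j
    have := congrArg (frobeniusAlgHom F K ^ (i : ℕ)) (hxC j)
    rw [map_sum, map_mul, frobeniusAlgHom_pow_apply _ ω] at this
    simp only [map_mul, AlgHom.commutes] at this
    exact this
  -- The entries of `y i` times `E` are its coordinates in the rows of `E⁻¹`; distinctness of the
  -- eigenvalues kills all but the `i`-th.
  have hrow (i : Fin n) : ∃ c : K, y i = c • E⁻¹ i := by
    refine ⟨Matrix.vecMul (y i) E i, ?_⟩
    have hz (k : Fin n) (hk : k ≠ i) : Matrix.vecMul (y i) E k = 0 := by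
      have h1 := congrArg (Matrix.vecMul (y i)) hCE
      rw [← Matrix.vecMul_vecMul, ← Matrix.vecMul_vecMul, hyC, Matrix.smul_vecMul] at h1
      have h2 := congrFun h1 k
      rw [hD, Matrix.vecMul_diagonal, Pi.smul_apply, smul_eq_mul, mul_comm] at h2
      by_contra h0
      exact hk (hinj (mul_left_cancel₀ h0 h2)).symm
    have h3 : y i = Matrix.vecMul (Matrix.vecMul (y i) E) E⁻¹ := by
      rw [Matrix.vecMul_vecMul, hEX, Matrix.vecMul_one]
    ext j
    conv_lhs => rw [h3]
    rw [Matrix.vecMul, dotProduct, Finset.sum_eq_single i]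
    · rfl
    · intro k _ hk
      rw [hz k hk, zero_mul]
    · simp
  choose c hc using hrow
  have hx0 : x ≠ 0 := by
    intro hx
    have h1 := congrFun (congrFun hXE i₀) i₀
    rw [Matrix.mul_apply, Matrix.one_apply_eq, Finset.sum_eq_zero] at h1
    · exact zero_ne_one h1
    · intro j _
      rw [show E⁻¹ i₀ j = 0 from congrFun hx j, zero_mul]
  have hc0 (i : Fin n) : c i ≠ 0 := by
    intro h0
    obtain ⟨j, hj⟩ := Function.ne_iff.1 hx0
    have h1 := congrFun (hc i) j
    rw [h0, zero_smul, Pi.zero_apply] at h1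
    exact hj ((map_eq_zero _).1 h1)
  refine ⟨x, ?_, ?_⟩
  · rw [Fintype.linearIndependent_iff]
    intro a ha
    -- Conjugating a relation over `F` among the entries of `x` gives the same relation for every
    -- row of the invertible `E⁻¹`.
    have hXa : Matrix.mulVec E⁻¹ (fun j => algebraMap F K (a j)) = 0 := by
      ext i
      have h1 := congrArg (frobeniusAlgHom F K ^ (i : ℕ)) ha
      rw [map_sum, map_zero] at h1
      have h2 : c i * Matrix.mulVec E⁻¹ (fun j => algebraMap F K (a j)) i = 0 := by
        rw [Matrix.mulVec, dotProduct, Finset.mul_sum, ← h1]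
        refine Finset.sum_congr rfl fun j _ => ?_
        rw [map_smul, ← mul_assoc, ← smul_eq_mul (c i), ← Pi.smul_apply, ← hc i,
          Algebra.smul_def, mul_comm]
      exact (mul_eq_zero.1 h2).resolve_left (hc0 i)
    have h3 : (fun j => algebraMap F K (a j)) = 0 := by
      have := congrArg (Matrix.mulVec E) hXa
      rwa [Matrix.mulVec_mulVec, hEX, Matrix.one_mulVec, Matrix.mulVec_zero] at this
    intro i
    exact (map_eq_zero _).1 (congrFun h3 i)
  · ext A
    -- Up to the factor `c i ^ 2`, the `i`-th diagonal entry is a conjugate of `quadEval F x A`, so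
    -- the `n` conditions are equivalent.
    have hiff (i : Fin n) : quadEval F (E⁻¹ i) A = 0 ↔ quadEval F x A = 0 := by
      have h1 : c i ^ 2 * quadEval F (E⁻¹ i) A =
          (frobeniusAlgHom F K ^ (i : ℕ)) (quadEval F x A) := by
        rw [← quadEval_smul, ← hc i, ← quadEval_algHom]
      have h2 := map_eq_zero (frobeniusAlgHom F K ^ (i : ℕ)) (a := quadEval F x A)
      rw [← h1, mul_eq_zero, or_iff_right (pow_ne_zero 2 (hc0 i))] at h2
      exact h2
    rw [LinearMap.mem_ker]
    change (∀ i, (E⁻¹ * A.map (algebraMap F K) * (E⁻¹).transpose) i i = 0) ↔ _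
    simp only [mul_map_mul_transpose_diag, hiff]
    exact ⟨fun h => h i₀, fun h _ => h⟩

theorem isMRD_ker_quadEval (hn : 2 ≤ n) (hK : finrank F K = n) {x : Fin n → K}
    (hx : LinearIndependent F x) :
    IsMRD (n - 1) (LinearMap.ker (quadEval F x) : Set (Matrix (Fin n) (Fin n) F)) := by
  refine ⟨by omega, by omega, ?_, ?_⟩
  · rw [min_self, show n - (n - 1) + 1 = 2 by omega]
    constructor
    · obtain ⟨A, hA, hA0, hA2⟩ := exists_mem_skewMatrices_rank_le_two (F := F) hn
      have hAx := skewMatrices_le_ker_quadEval x hA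
      refine ⟨A, hAx, 0, Submodule.zero_mem _, hA0, ?_⟩
      rw [sub_zero]
      exact le_antisymm (two_le_rank_of_quadEval_eq_zero hx hAx hA0) hA2
    · rintro _ ⟨A, hA, B, hB, hAB, rfl⟩
      exact two_le_rank_of_quadEval_eq_zero hx (Submodule.sub_mem _ hA hB) (sub_ne_zero.2 hAB)
  · change Nat.card (LinearMap.ker (quadEval F x)) = _
    rw [Module.natCard_eq_pow_finrank (K := F), Nat.card_eq_fintype_card, max_self,
      finrank_ker_quadEval (by omega) hK hx]

end SingerCode

end SubspaceCodes

theorem proposition3p2 {F : Type*} [Field F] [Fintype F] {n : ℕ} (hn : 4 ≤ n)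
    {K : Type*} [Field K] [Algebra F K] (hK : Module.finrank F K = n) :
    -- Singer cycles of `GL(n, q)` exist, and each yields a linear `(n, n, n - 1)` MRD code that
    -- contains the skew-symmetric matrices with zero diagonal
    (∃ (ω : K) (C : Matrix (Fin n) (Fin n) F) (E : Matrix (Fin n) (Fin n) K),
      SubspaceCodes.IsSingerDiagonalization ω C E) ∧
    (∀ (ω : K) (C : Matrix (Fin n) (Fin n) F) (E : Matrix (Fin n) (Fin n) K),
      SubspaceCodes.IsSingerDiagonalization ω C E →
        SubspaceCodes.IsMRD (n - 1)
          (SubspaceCodes.singerCode F E : Set (Matrix (Fin n) (Fin n) F)) ∧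
        SubspaceCodes.skewMatrices F n ≤ SubspaceCodes.singerCode F E) ∧
    -- for this and every other linear `(n, n, n - 1)` MRD code, the union of the lifted codes is
    -- a `(2n, M, 4; n)_q` code with the stated `M`
    (∀ 𝓜 : Submodule F (Matrix (Fin n) (Fin n) F),
      SubspaceCodes.IsMRD (n - 1) (𝓜 : Set (Matrix (Fin n) (Fin n) F)) →
        ∃ M : ℕ, (M : ℚ) = SubspaceCodes.codeSize (Fintype.card F) n ∧
          SubspaceCodes.IsConstantDimensionCode (2 * n) M 4 n
            (SubspaceCodes.liftedUnion (𝓜 : Set (Matrix (Fin n) (Fin n) F)))) := by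
  refine ⟨SubspaceCodes.exists_isSingerDiagonalization (by omega) hK, fun ω C E h => ?_,
    fun 𝓜 h𝓜 => SubspaceCodes.exists_isConstantDimensionCode hn h𝓜⟩
  obtain ⟨x, hx, hE⟩ := h.exists_linearIndependent (by omega)
  rw [hE]
  exact ⟨SubspaceCodes.isMRD_ker_quadEval (by omega) hK hx,
    SubspaceCodes.skewMatrices_le_ker_quadEval x⟩
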